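/- Let $H$ be a complex Hilbert space with an orthonormal basis $(e_n)_{n\ge 0}$, let $(\omega_n)_{n\ge 0}$ be a bounded sequence of positive real numbers, and let $S$ be the unilateral weighted shift on $H$ with these weights, i.e. the bounded linear operator with $Se_n=\omega_n e_{n+1}$ for all $n\ge 0$. Let $r(S)$ denote the spectral radius of $S$, and let $$r_1(S)=\sup_{n\ge 1}\,[m(S^n)]^{1/n},\qquad m(T)=\inf\{\|Tx\|:\|x\|=1\}.$$ For an open set $U\subset\mathbb{C}$, let $\mathcal{O}(U,H)$ be the space of analytic functions $U\to H$ with the topology of uniform convergence on compact subsets of $U$, and define $S_U:\mathcal{O}(U,H)\to\mathcal{O}(U,H)$ by $(S_Uf)(\lambda)=(S-\lambda)f(\lambda)$. The operator $S$ possesses Bishop's property $(\beta)$ if, for every open $U\subset\mathbb{C}$, the map $S_U$ is injective and has closed range; it possesses Bishop's property $(\beta)$ at $\lambda_0\in\mathbb{C}$ if there is an open neighbourhood $V$ of $\lambda_0$ such that, for every open $U\subset V$, the map $S_U$ is injective and has closed range. Let $\sigma_\beta(S)$ be the set of all $\lambda\in\mathbb{C}$ at which $S$ fails to possess Bishop's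 property $(\beta)$. If $S$ possesses Bishop's property $(\beta)$, then $r_1(S)=r(S)$. Conversely, if $r_1(S)=r(S)$, then either $S$ possesses Bishop's property $(\beta)$, or $\sigma_\beta(S)=\{\lambda\in\mathbb{C}:|\lambda|=r(S)\}$. -/

import Mathlib

/-- The space `𝒪(U, H)` of analytic `H`-valued functions on an open set `U ⊆ ℂ`.  As a subspace of
`C(U, H)` it carries the compact-open topology, i.e. the topology of uniform convergence on the
compact subsets of `U`. -/
noncomputable def analyticFunctions (U : TopologicalSpace.Opens ℂ) (H : Type*) [NormedAddCommGroup H]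
    [NormedSpace ℂ H] : Submodule ℂ C(U, H) where
  carrier := {f | ∃ F : ℂ → H, AnalyticOnNhd ℂ F (U : Set ℂ) ∧ ∀ z : U, f z = F z}
  add_mem' := by
    rintro f g ⟨F, hF, hf⟩ ⟨G, hG, hg⟩
    exact ⟨F + G, hF.add hG, fun z => by simp [hf z, hg z]⟩
  zero_mem' := ⟨0, fun _ _ => analyticAt_const, fun _ => rfl⟩
  smul_mem' := by
    rintro c f ⟨F, hF, hf⟩
    exact ⟨fun z => c • F z, fun z hz => analyticAt_const.smul (hF z hz),
      fun z => by simp [hf z]⟩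

section
variable {H : Type*} [NormedAddCommGroup H] [NormedSpace ℂ H]

/-- The map `T_U` on `𝒪(U, H)`, given by `(T_U f)(z) = (T - z) f(z)` for `z ∈ U`. -/
noncomputable def inducedMap (T : H →L[ℂ] H) (U : TopologicalSpace.Opens ℂ) :
    analyticFunctions U H →ₗ[ℂ] analyticFunctions U H where
  toFun f :=
    ⟨⟨fun z => T (f.1 z) - (z : ℂ) • f.1 z, by fun_prop⟩, by
      obtain ⟨F, hF, hf⟩ := f.2
      refine ⟨fun z => T (F z) - z • F z, fun z hz => ?_, fun z => by simp [hf z]⟩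
      exact ((T.analyticAt _).comp (hF z hz)).sub (analyticAt_id.smul (hF z hz))⟩
  map_add' f g := by
    apply Subtype.ext
    ext z
    simp only [Submodule.coe_add, ContinuousMap.coe_mk, ContinuousMap.add_apply, map_add, smul_add]
    abel
  map_smul' c f := by
    apply Subtype.ext
    ext z
    simp [smul_sub, smul_comm c (z : ℂ)]

/-- Bishop's property `(β)`: for every open `U ⊆ ℂ`, the map `T_U` is injective and has a closed
range in `𝒪(U, H)`. -/
def HasBishopBeta (T : H →L[ℂ] H) : Prop :=
  ∀ U : TopologicalSpace.Opens ℂ,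
    Function.Injective (inducedMap T U) ∧ IsClosed (Set.range (inducedMap T U))

/-- Bishop's property `(β)` at a point `z₀`: there is an open neighbourhood `V` of `z₀` such that
for every open `U ⊆ V`, the map `T_U` is injective and has a closed range. -/
def HasBishopBetaAt (T : H →L[ℂ] H) (z₀ : ℂ) : Prop :=
  ∃ V : TopologicalSpace.Opens ℂ, z₀ ∈ V ∧ ∀ U : TopologicalSpace.Opens ℂ, U ≤ V →
    Function.Injective (inducedMap T U) ∧ IsClosed (Set.range (inducedMap T U))

/-- The set `σ_β(T)` of the points at which `T` fails to possess Bishop's property `(β)`. -/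
def sigmaBeta (T : H →L[ℂ] H) : Set ℂ := {z | ¬ HasBishopBetaAt T z}

/-- The lower bound `m(T) = inf {‖T x‖ : ‖x‖ = 1}`. -/
noncomputable def lowerBound (T : H →L[ℂ] H) : ℝ := sInf {t : ℝ | ∃ x : H, ‖x‖ = 1 ∧ t = ‖T x‖}

/-- `r₁(T) = sup_{n ≥ 1} m(T ^ n) ^ (1 / n)`; this set of reals is bounded above by `‖T‖`
(if `H ≠ 0`). -/
noncomputable def innerRadius (T : H →L[ℂ] H) : ℝ :=
  sSup {t : ℝ | ∃ n : ℕ, 1 ≤ n ∧ t = lowerBound (T ^ n) ^ (1 / (n : ℝ))}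

/-- The spectral radius `r(T)` as a real number (Mathlib's `spectralRadius` is an extended
nonnegative real, and it is at most `‖T‖`). -/
noncomputable def outerRadius (T : H →L[ℂ] H) : ℝ := (spectralRadius ℂ T).toReal

end

/-- `S` is the unilateral weighted shift with weights `ω` with respect to the orthonormal basis
`e`: the weights are positive and bounded, and `S e_n = ω_n e_{n+1}` for all `n ≥ 0`. -/
structure IsUnilateralWeightedShift {H : Type*} [NormedAddCommGroup H] [InnerProductSpace ℂ H]
    (e : HilbertBasis ℕ ℂ H) (ω : ℕ → ℝ) (S : H →L[ℂ] H) : Prop where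
  weight_pos : ∀ n, 0 < ω n
  weight_bddAbove : BddAbove (Set.range ω)
  apply_basis : ∀ n, S (e n) = (ω n : ℂ) • e (n + 1)

/-! Put β_n = ω_0 ⋯ ω_{n-1}. The norm and the lower bound of S^m are governed by the ratios
β_{k+m}/β_k, so r(S) and r₁(S) are the extreme growth rates of β over long stretches.

Suppose r₁(S) < r(S). Then, arbitrarily far out, β has long stretches growing at rate at least X and
long stretches growing at rate at most Y < X. Splitting at an intermediate rate M yields peaks: fast
growth up to an index p, then slow growth, for rates v < u (`hasPeaks_or_hasPeaks`). Over one peak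
the formal solution of (S - z) f = 0, cut to the block and normalised to have coordinate 1 at p, is
mapped by S - z to two end terms, which are tiny on v < |z| < u. The images of infinitely many
disjoint blocks therefore have a convergent sum g in the closure of the range. Any solution of (S -
z) F = g has coordinate 1 at every peak, which is impossible in H. So (β) fails.

Suppose r₁(S) = r(S). Off the circle |z| = r(S) the operator S - z has a bounded left inverse, which
gives (β) at z. The shift is unitarily equivalent to its rotations, so on the circle (β) holds at
every point or at none. As S has no eigenvalues, local solutions are unique and glue, so (β) at
every point gives (β). -/

open Filter Topology

/-! ### Closed range of `T_U`: local inverses, gluing, change of variables -/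

section InducedMap

variable {H : Type*} [NormedAddCommGroup H] [NormedSpace ℂ H]

theorem inducedMap_apply (T : H →L[ℂ] H) (U : TopologicalSpace.Opens ℂ)
    (f : analyticFunctions U H) (z : U) :
    (inducedMap T U f).1 z = T (f.1 z) - (z : ℂ) • f.1 z := rfl

theorem mem_range_inducedMap_iff {T : H →L[ℂ] H} {U : TopologicalSpace.Opens ℂ}
    {g : analyticFunctions U H} :
    g ∈ Set.range (inducedMap T U) ↔ ∃ F : ℂ → H, AnalyticOnNhd ℂ F (U : Set ℂ) ∧
      ∀ z : U, g.1 z = T (F z) - (z : ℂ) • F z := by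
  constructor
  · rintro ⟨f, rfl⟩
    obtain ⟨F, hF, hf⟩ := f.2
    exact ⟨F, hF, fun z => by rw [inducedMap_apply, hf z]⟩
  · rintro ⟨F, hF, h⟩
    refine ⟨⟨⟨fun z : U => F z, ?_⟩, F, hF, fun z => rfl⟩, ?_⟩
    · exact continuousOn_iff_continuous_domRestrict.mp hF.continuousOn
    · apply Subtype.ext
      ext z
      rw [inducedMap_apply, h z]
      rfl

theorem injective_inducedMap {T : H →L[ℂ] H} {U : TopologicalSpace.Opens ℂ}
    (h : ∀ z ∈ U, ∀ x, T x = z • x → x = 0) : Function.Injective (inducedMap T U) := by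
  rw [injective_iff_map_eq_zero]
  intro f hf
  apply Subtype.ext
  ext z
  refine h z z.2 _ (sub_eq_zero.mp ?_)
  rw [← inducedMap_apply, hf]
  rfl

/-- Values at a point of the closure of the range of `T_U` lie in the closure of the range of
`T - z`. -/
theorem apply_mem_closure_range {T : H →L[ℂ] H} {U : TopologicalSpace.Opens ℂ}
    {g : analyticFunctions U H} (hg : g ∈ closure (Set.range (inducedMap T U))) (z : U) :
    g.1 z ∈ closure (Set.range fun x => T x - (z : ℂ) • x) := by
  have hc : Continuous fun f : analyticFunctions U H => f.1 z :=
    (continuous_eval_const z).comp continuous_subtype_val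
  refine map_mem_closure (f := fun f : analyticFunctions U H => f.1 z) hc hg ?_
  rintro _ ⟨f, rfl⟩
  exact ⟨f.1 z, rfl⟩

/-- If `T - z` has a bounded left inverse for every `z ∈ U`, then `T_U` is injective and has a
closed range. -/
theorem injective_and_isClosed_range_of_leftInverse [CompleteSpace H] {T : H →L[ℂ] H}
    {U : TopologicalSpace.Opens ℂ}
    (h : ∀ z ∈ U, ∃ L : H →L[ℂ] H, ∀ x, L (T x - z • x) = x) :
    Function.Injective (inducedMap T U) ∧ IsClosed (Set.range (inducedMap T U)) := by
  constructor
  · refine injective_inducedMap fun z hz x hx => ?_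
    obtain ⟨L, hL⟩ := h z hz
    rw [← hL x, hx, sub_self, map_zero]
  refine isClosed_of_closure_subset fun g hg => ?_
  have hex : ∀ z, ∃ x, ∀ hz : z ∈ U, g.1 ⟨z, hz⟩ = T x - z • x := by
    intro z
    by_cases hz : z ∈ U
    · obtain ⟨L, hL⟩ := h z hz
      have hcl : IsClosed (Set.range fun x => T x - z • x) := by
        -- The range of T - z is the fixed-point set of the continuous map (T - z) L, hence closed.
        have hset : (Set.range fun x => T x - z • x) = {y | T (L y) - z • L y = y} := by
          ext y
          constructor
          · rintro ⟨x, rfl⟩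
            simp only [Set.mem_ofPred_eq, hL]
          · intro hy
            exact ⟨L y, hy⟩
        rw [hset]
        exact isClosed_eq (by fun_prop) continuous_id
      have := apply_mem_closure_range hg ⟨z, hz⟩
      rw [hcl.closure_eq] at this
      obtain ⟨x, hx⟩ := this
      exact ⟨x, fun _ => hx.symm⟩
    · exact ⟨0, fun hz' => absurd hz' hz⟩
  choose F hF using hex
  refine mem_range_inducedMap_iff.mpr ⟨F, fun z₀ hz₀ => ?_, fun z => hF z z.2⟩
  obtain ⟨G, hG, hgG⟩ := g.2
  obtain ⟨L, hL⟩ := h z₀ hz₀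
  -- L (T - z) = 1 - (z - z₀) L, which is invertible near z₀; so there F z = A(z)⁻¹ L (G z), an
  -- analytic expression.
  let A : ℂ → (H →L[ℂ] H) := fun z => 1 - (z - z₀) • L
  have hA : AnalyticAt ℂ A z₀ :=
    analyticAt_const.sub ((analyticAt_id.sub analyticAt_const).smul analyticAt_const)
  have hA1 : A z₀ = 1 := by simp [A]
  have hinv : AnalyticAt ℂ (fun z => Ring.inverse (A z)) z₀ := by
    have h1 : AnalyticAt ℂ Ring.inverse (A z₀) := by
      rw [hA1]
      exact analyticAt_inverse (𝕜 := ℂ) (1 : (H →L[ℂ] H)ˣ)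
    exact h1.comp hA
  have hunit : ∀ᶠ z in 𝓝 z₀, IsUnit (A z) := by
    refine hA.continuousAt.eventually_mem (Units.isOpen.mem_nhds ?_)
    rw [hA1]
    exact isUnit_one
  have hana : AnalyticAt ℂ (fun z => Ring.inverse (A z) (L (G z))) z₀ :=
    ((ContinuousLinearMap.id ℂ (H →L[ℂ] H)).analyticAt_bilinear _).comp
      (hinv.prod ((L.analyticAt _).comp (hG z₀ hz₀)))
  refine hana.congr ?_
  filter_upwards [hunit, U.isOpen.mem_nhds hz₀] with z hu hz
  have h1 : L (G z) = A z (F z) := by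
    rw [← hgG ⟨z, hz⟩, hF z hz]
    have : T (F z) - z • F z = (T (F z) - z₀ • F z) - (z - z₀) • F z := by
      rw [sub_smul]; abel
    rw [this, map_sub, hL]
    simp [A]
  change Ring.inverse (A z) (L (G z)) = F z
  rw [h1]
  exact DFunLike.congr_fun (Ring.inverse_mul_cancel _ hu) (F z)

/-- Transport of the closure of the range of `T_U` along an analytic change of variables
intertwining `T - φ z` and `T - z`. -/
theorem exists_analyticOnNhd_of_mem_closure_range {T A B : H →L[ℂ] H}
    {U V : TopologicalSpace.Opens ℂ} {φ : ℂ → ℂ} (hφ : AnalyticOnNhd ℂ φ (V : Set ℂ))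
    (hφU : ∀ z ∈ V, φ z ∈ U) (hAB : ∀ z ∈ V, ∀ x, A (T x - φ z • x) = T (B x) - z • B x)
    (hV : IsClosed (Set.range (inducedMap T V))) {g : analyticFunctions U H}
    (hg : g ∈ closure (Set.range (inducedMap T U))) :
    ∃ F : ℂ → H, AnalyticOnNhd ℂ F (V : Set ℂ) ∧
      ∀ z (hz : z ∈ V), A (g.1 ⟨φ z, hφU z hz⟩) = T (F z) - z • F z := by
  let p : C(V, U) := ⟨fun z => ⟨φ z, hφU z z.2⟩,
    (continuousOn_iff_continuous_domRestrict.mp hφ.continuousOn).subtype_mk _⟩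
  let q : C(H, H) := ⟨A, A.continuous⟩
  -- f ↦ A ∘ f ∘ φ is continuous and, by `hAB`, carries the range of `T_U` into that of `T_V`.
  let Φ : analyticFunctions U H → analyticFunctions V H := fun f =>
    ⟨(q.comp f.1).comp p, by
      obtain ⟨F, hF, hf⟩ := f.2
      refine ⟨fun z => A (F (φ z)), fun z hz => ?_, fun z => ?_⟩
      · exact (A.analyticAt _).comp ((hF _ (hφU z hz)).comp (hφ z hz))
      · exact congrArg A (hf _)⟩
  have hΦ : Continuous Φ := Continuous.subtype_mk
    ((ContinuousMap.continuous_precomp p).comp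
      ((ContinuousMap.continuous_postcomp q).comp continuous_subtype_val)) _
  have hmem : Φ g ∈ closure (Set.range (inducedMap T V)) := by
    refine map_mem_closure hΦ hg ?_
    rintro _ ⟨f, rfl⟩
    obtain ⟨F, hF, hf⟩ := f.2
    refine mem_range_inducedMap_iff.mpr ⟨fun z => B (F (φ z)), fun z hz => ?_, fun z => ?_⟩
    · exact (B.analyticAt _).comp ((hF _ (hφU z hz)).comp (hφ z hz))
    · rw [← hAB z z.2, ← hf ⟨φ z, hφU z z.2⟩]
      rfl
  rw [hV.closure_eq] at hmem
  obtain ⟨F, hF, h⟩ := mem_range_inducedMap_iff.mp hmem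
  exact ⟨F, hF, fun z hz => h ⟨z, hz⟩⟩

/-- An operator without eigenvalues which has property `(β)` at every point has
property `(β)`. -/
theorem hasBishopBeta_of_forall_hasBishopBetaAt {T : H →L[ℂ] H}
    (hT : ∀ (z : ℂ) (x : H), T x = z • x → x = 0) (h : ∀ z, HasBishopBetaAt T z) :
    HasBishopBeta T := by
  intro U
  refine ⟨injective_inducedMap fun z _ => hT z, isClosed_of_closure_subset fun g hg => ?_⟩
  have hloc : ∀ z ∈ U, ∃ V : TopologicalSpace.Opens ℂ, z ∈ V ∧ ∃ hVU : V ≤ U, ∃ F : ℂ → H,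
      AnalyticOnNhd ℂ F (V : Set ℂ) ∧
        ∀ z (hz : z ∈ V), g.1 ⟨z, hVU hz⟩ = T (F z) - z • F z := by
    intro z hz
    obtain ⟨V, hzV, hV⟩ := h z
    refine ⟨U ⊓ V, ⟨hz, hzV⟩, inf_le_left, ?_⟩
    exact exists_analyticOnNhd_of_mem_closure_range (A := .id ℂ H) (B := .id ℂ H)
      (V := U ⊓ V) (φ := fun z => z) (fun z _ => analyticAt_id) (fun z hz => hz.1) (fun z _ x => rfl) (hV _ inf_le_right).2 hg
  have hex : ∀ z, ∃ x, ∀ hz : z ∈ U, g.1 ⟨z, hz⟩ = T x - z • x := by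
    intro z
    by_cases hz : z ∈ U
    · obtain ⟨V, hzV, hVU, F, -, hF⟩ := hloc z hz
      exact ⟨F z, fun _ => hF z hzV⟩
    · exact ⟨0, fun hz' => absurd hz' hz⟩
  choose F hF using hex
  refine mem_range_inducedMap_iff.mpr ⟨F, fun z hz => ?_, fun z => hF z z.2⟩
  obtain ⟨V, hzV, hVU, G, hG, hgG⟩ := hloc z hz
  refine (hG z hzV).congr ?_
  filter_upwards [V.isOpen.mem_nhds hzV] with w hw
  -- Two solutions at w differ by a vector in the kernel of T - w, which is trivial; so F agrees
  -- with the analytic G near z.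
  refine sub_eq_zero.mp (hT w _ (sub_eq_zero.mp ?_))
  rw [map_sub, smul_sub, sub_sub_sub_comm, ← hgG w hw, ← hF w (hVU hw), sub_self]

/-- If `T` is similar to `w⁻¹ T`, then property `(β)` is transported from `z` to `w z`. -/
theorem HasBishopBetaAt.mul_left {T : H →L[ℂ] H} (hT : ∀ (z : ℂ) (x : H), T x = z • x → x = 0)
    {w : ℂ} (hw : w ≠ 0) (W : H ≃L[ℂ] H) (hW : ∀ x, W (T x) = w • T (W x)) {z : ℂ}
    (h : HasBishopBetaAt T z) : HasBishopBetaAt T (w * z) := by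
  obtain ⟨V, hzV, hV⟩ := h
  refine ⟨⟨(fun y => w⁻¹ * y) ⁻¹' V, V.isOpen.preimage (by fun_prop)⟩, ?_, fun U hU =>
    ⟨injective_inducedMap fun z _ => hT z, isClosed_of_closure_subset fun g hg => ?_⟩⟩
  · change w⁻¹ * (w * z) ∈ V
    rwa [inv_mul_cancel_left₀ hw]
  let V' : TopologicalSpace.Opens ℂ := ⟨(fun y => w * y) ⁻¹' U, U.isOpen.preimage (by fun_prop)⟩
  have hV' : V' ≤ V := by
    intro y hy
    have : w⁻¹ * (w * y) ∈ V := hU hy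
    rwa [inv_mul_cancel_left₀ hw] at this
  -- W T = w T W gives w⁻¹ W (T - w y) = (T - y) W. The problem on U is solved on w⁻¹ U ⊆ V and
  -- carried back by W⁻¹.
  obtain ⟨F, hF, hgF⟩ := exists_analyticOnNhd_of_mem_closure_range (φ := fun y => w * y)
    (A := w⁻¹ • (W : H →L[ℂ] H)) (B := W) (V := V')
    (fun z _ => analyticAt_const.mul analyticAt_id) (fun z hz => hz)
    (fun z _ x => by
      change w⁻¹ • W (T x - (w * z) • x) = T (W x) - z • W x
      rw [map_sub, hW, map_smul, smul_sub, smul_smul, smul_smul, inv_mul_cancel₀ hw, one_smul,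
        inv_mul_cancel_left₀ hw])
    (hV V' hV').2 hg
  refine mem_range_inducedMap_iff.mpr ⟨fun y => W.symm (F (w⁻¹ * y)), fun y hy => ?_, fun y => ?_⟩
  · refine ((W.symm : H →L[ℂ] H).analyticAt _).comp
      ((hF (w⁻¹ * y) ?_).comp (analyticAt_const.mul analyticAt_id))
    change w * (w⁻¹ * y) ∈ U
    rwa [mul_inv_cancel_left₀ hw]
  · have hy : w⁻¹ * (y : ℂ) ∈ V' := by
      change w * (w⁻¹ * y) ∈ U
      rw [mul_inv_cancel_left₀ hw]
      exact y.2
    have h1 := hgF _ hy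
    simp only [mul_inv_cancel_left₀ hw] at h1
    apply W.injective
    rw [map_sub, hW, map_smul, W.apply_symm_apply]
    have h2 : W (g.1 y) = w • (w⁻¹ • (W : H →L[ℂ] H)) (g.1 y) := by
      simp [smul_smul, mul_inv_cancel₀ hw]
    rw [h2, h1, smul_sub, smul_smul, mul_inv_cancel_left₀ hw]

end InducedMap

/-! ### Left inverses in Hilbert space -/

section LeftInverse

variable {H : Type*} [NormedAddCommGroup H] [InnerProductSpace ℂ H] [CompleteSpace H]

/-- An operator on a Hilbert space which is bounded below has a bounded left inverse. -/
theorem exists_leftInverse_of_bound {A : H →L[ℂ] H} {c : ℝ} (hc : 0 < c)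
    (h : ∀ x, c * ‖x‖ ≤ ‖A x‖) : ∃ L : H →L[ℂ] H, ∀ x, L (A x) = x := by
  have hanti : AntilipschitzWith (c⁻¹).toNNReal A := A.antilipschitz_of_bound fun x => by
    rw [Real.coe_toNNReal _ (inv_nonneg.mpr hc.le), ← div_eq_inv_mul, le_div_iff₀' hc]
    exact h x
  have hcl : IsClosed (Set.range A) := hanti.isClosed_range A.uniformContinuous
  have hcl' : IsClosed ((A : H →ₗ[ℂ] H).range : Set H) := hcl
  have : CompleteSpace (A : H →ₗ[ℂ] H).range := hcl'.completeSpace_coe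
  exact ContinuousLinearMap.HasLeftInverse.of_injective_of_isClosed_range_of_closedComplement_range
    hanti.injective hcl ⟨(A : H →ₗ[ℂ] H).range.orthogonalProjectionOnto, fun x =>
      Submodule.orthogonalProjectionOnto_mem_subspace_eq_self x⟩

end LeftInverse

/-! ### Inner and spectral radius -/

section Radii

variable {H : Type*} [NormedAddCommGroup H] [NormedSpace ℂ H]

theorem lowerBound_mul_norm_le (T : H →L[ℂ] H) (x : H) : lowerBound T * ‖x‖ ≤ ‖T x‖ := by
  rcases eq_or_ne x 0 with rfl | hx
  · simp
  have hx' : 0 < ‖x‖ := norm_pos_iff.mpr hx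
  rw [← le_div_iff₀ hx']
  refine csInf_le ⟨0, ?_⟩ ⟨(‖x‖⁻¹ : ℂ) • x, ?_, ?_⟩
  · rintro _ ⟨y, -, rfl⟩
    exact norm_nonneg _
  · rw [norm_smul, norm_inv, Complex.norm_real, norm_norm, inv_mul_cancel₀ hx'.ne']
  · rw [map_smul, norm_smul, norm_inv, Complex.norm_real, norm_norm, div_eq_inv_mul]

theorem lowerBound_nonneg (T : H →L[ℂ] H) : 0 ≤ lowerBound T := by
  refine Real.sInf_nonneg ?_
  rintro _ ⟨x, -, rfl⟩
  exact norm_nonneg _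

theorem le_lowerBound [Nontrivial H] {T : H →L[ℂ] H} {c : ℝ} (h : ∀ x, c * ‖x‖ ≤ ‖T x‖) :
    c ≤ lowerBound T := by
  obtain ⟨x, hx⟩ := exists_norm_eq (E := H) zero_le_one
  refine le_csInf ⟨_, x, hx, rfl⟩ ?_
  rintro _ ⟨y, hy, rfl⟩
  simpa [hy] using h y

theorem lowerBound_le_norm [Nontrivial H] (T : H →L[ℂ] H) : lowerBound T ≤ ‖T‖ := by
  obtain ⟨x, hx⟩ := exists_norm_eq (E := H) zero_le_one
  have h1 := lowerBound_mul_norm_le T x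
  have h2 := T.le_opNorm x
  rw [hx, mul_one] at h1 h2
  exact h1.trans h2

theorem lowerBound_pow_mul_norm_le (T : H →L[ℂ] H) (k : ℕ) (x : H) :
    lowerBound T ^ k * ‖x‖ ≤ ‖(T ^ k) x‖ := by
  induction k with
  | zero => simp
  | succ k ih =>
    rw [pow_succ' T]
    calc lowerBound T ^ (k + 1) * ‖x‖ = lowerBound T * (lowerBound T ^ k * ‖x‖) := by ring
      _ ≤ lowerBound T * ‖(T ^ k) x‖ := mul_le_mul_of_nonneg_left ih (lowerBound_nonneg T)
      _ ≤ _ := lowerBound_mul_norm_le T _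

theorem lowerBound_rpow_le_innerRadius [Nontrivial H] (T : H →L[ℂ] H) {n : ℕ} (hn : 1 ≤ n) :
    lowerBound (T ^ n) ^ (1 / (n : ℝ)) ≤ innerRadius T := by
  refine le_csSup ⟨‖T‖, ?_⟩ ⟨n, hn, rfl⟩
  rintro _ ⟨k, hk, rfl⟩
  have hk' : k ≠ 0 := by omega
  rw [one_div]
  refine (Real.rpow_le_rpow (lowerBound_nonneg _)
    ((lowerBound_le_norm _).trans (norm_pow_le' T hk)) (by positivity)).trans_eq ?_
  exact Real.pow_rpow_inv_natCast (norm_nonneg _) hk'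

theorem innerRadius_nonneg (T : H →L[ℂ] H) : 0 ≤ innerRadius T := by
  refine Real.sSup_nonneg ?_
  rintro _ ⟨n, -, rfl⟩
  exact Real.rpow_nonneg (lowerBound_nonneg _) _

theorem outerRadius_nonneg (T : H →L[ℂ] H) : 0 ≤ outerRadius T := ENNReal.toReal_nonneg

theorem exists_pow_lt_lowerBound_of_lt_innerRadius {T : H →L[ℂ] H} {c : ℝ} (hc0 : 0 ≤ c)
    (hc : c < innerRadius T) : ∃ n, 1 ≤ n ∧ c ^ n < lowerBound (T ^ n) := by
  obtain ⟨_, ⟨n, hn, rfl⟩, h⟩ := exists_lt_of_lt_csSup (by exact ⟨_, 1, le_rfl, rfl⟩) hc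
  refine ⟨n, hn, ?_⟩
  have hn' : n ≠ 0 := by omega
  calc c ^ n < (lowerBound (T ^ n) ^ (1 / (n : ℝ))) ^ n := pow_lt_pow_left₀ h hc0 hn'
    _ = lowerBound (T ^ n) := by
      rw [one_div, Real.rpow_inv_natCast_pow (lowerBound_nonneg _) hn']

/-- Exponential lower bounds for `‖T ^ m x‖` bound the inner radius from below. -/
theorem le_innerRadius_of_bound [Nontrivial H] {T : H →L[ℂ] H} {c δ : ℝ} (hc : 0 < c)
    (hδ : 0 < δ) {N : ℕ} (h : ∀ m ≥ N, ∀ x, δ * c ^ m * ‖x‖ ≤ ‖(T ^ m) x‖) :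
    c ≤ innerRadius T := by
  by_contra! hlt
  have hle : ∀ m ≥ N + 1, δ ≤ (innerRadius T / c) ^ m := by
    intro m hm
    have hm' : m ≠ 0 := by omega
    have h1 := le_lowerBound (h m (by omega))
    have h2 : lowerBound (T ^ m) ≤ innerRadius T ^ m := by
      rw [← Real.rpow_inv_natCast_pow (lowerBound_nonneg (T ^ m)) hm', ← one_div]
      exact pow_le_pow_left₀ (Real.rpow_nonneg (lowerBound_nonneg _) _)
        (lowerBound_rpow_le_innerRadius T (by omega)) m
    rw [div_pow, le_div_iff₀ (by positivity)]
    exact h1.trans h2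
  have hlim := tendsto_pow_atTop_nhds_zero_of_lt_one
    (div_nonneg (innerRadius_nonneg T) hc.le) ((div_lt_one hc).mpr hlt)
  exact hδ.not_ge (ge_of_tendsto hlim (eventually_atTop.mpr ⟨_, hle⟩))

/-- Below the inner radius `T - z` is bounded below. -/
theorem exists_bound_of_lt_innerRadius {T : H →L[ℂ] H} {z : ℂ} (hz : ‖z‖ < innerRadius T) :
    ∃ c > 0, ∀ x, c * ‖x‖ ≤ ‖(T - z • 1 : H →L[ℂ] H) x‖ := by
  obtain ⟨n, hn, h⟩ := exists_pow_lt_lowerBound_of_lt_innerRadius (norm_nonneg z) hz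
  have hcomm : Commute T (z • 1 : H →L[ℂ] H) := (Commute.one_right T).smul_right z
  -- T^n - z^n = Q (T - z), and T^n - z^n is bounded below because |z|^n < m(T^n).
  set Q := ∑ i ∈ Finset.range n, T ^ i * (z • 1 : H →L[ℂ] H) ^ (n - 1 - i) with hQ
  have hQT : Q * (T - z • 1) = T ^ n - (z • 1) ^ n := hcomm.geom_sum₂_mul n
  refine ⟨(lowerBound (T ^ n) - ‖z‖ ^ n) / (‖Q‖ + 1),
    div_pos (sub_pos.mpr h) (by positivity), fun x => ?_⟩
  rw [div_mul_eq_mul_div, div_le_iff₀ (by positivity)]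
  calc (lowerBound (T ^ n) - ‖z‖ ^ n) * ‖x‖
      ≤ ‖(T ^ n) x‖ - ‖z ^ n • x‖ := by
        rw [sub_mul, norm_smul, norm_pow]
        exact sub_le_sub_right (lowerBound_mul_norm_le _ x) _
    _ ≤ ‖(T ^ n) x - z ^ n • x‖ := norm_sub_norm_le _ _
    _ = ‖Q ((T - z • 1 : H →L[ℂ] H) x)‖ := by
        have h1 : Q ((T - z • 1 : H →L[ℂ] H) x) = (T ^ n - (z • 1) ^ n : H →L[ℂ] H) x :=
          DFunLike.congr_fun hQT x
        rw [h1]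
        simp [smul_pow]
    _ ≤ ‖Q‖ * ‖(T - z • 1 : H →L[ℂ] H) x‖ := Q.le_opNorm _
    _ ≤ ‖(T - z • 1 : H →L[ℂ] H) x‖ * (‖Q‖ + 1) := by
        rw [mul_comm]
        exact mul_le_mul_of_nonneg_left (by linarith) (norm_nonneg _)

variable [CompleteSpace H]

theorem spectralRadius_ne_top (T : H →L[ℂ] H) : spectralRadius ℂ T ≠ ⊤ := by
  refine ne_top_of_le_ne_top ?_ (spectrum.spectralRadius_le_pow_nnnorm_pow_one_div ℂ T 0)
  simp [ENNReal.mul_eq_top]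

theorem tendsto_norm_pow_rpow_outerRadius (T : H →L[ℂ] H) :
    Tendsto (fun n : ℕ => ‖T ^ n‖ ^ (1 / (n : ℝ))) atTop (𝓝 (outerRadius T)) := by
  have h := (ENNReal.tendsto_toReal (spectralRadius_ne_top T)).comp
    (spectrum.pow_norm_pow_one_div_tendsto_nhds_spectralRadius T)
  refine h.congr fun n => ?_
  exact ENNReal.toReal_ofReal (Real.rpow_nonneg (norm_nonneg _) _)

/-- Exponential upper bounds for `‖T ^ m‖` bound the spectral radius from above. -/
theorem outerRadius_le_of_bound {T : H →L[ℂ] H} {c C : ℝ} (hc : 0 < c) (hC : 0 < C) {N : ℕ}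
    (h : ∀ m ≥ N, ‖T ^ m‖ ≤ C * c ^ m) : outerRadius T ≤ c := by
  have hlim : Tendsto (fun n : ℕ => C ^ (1 / (n : ℝ)) * c) atTop (𝓝 c) := by
    have h1 : Tendsto (fun n : ℕ => C ^ (1 / (n : ℝ))) atTop (𝓝 (C ^ (0 : ℝ))) :=
      (Real.continuousAt_const_rpow hC.ne').tendsto.comp tendsto_one_div_atTop_nhds_zero_nat
    simpa using h1.mul_const c
  refine le_of_tendsto_of_tendsto (tendsto_norm_pow_rpow_outerRadius T) hlim ?_
  filter_upwards [eventually_ge_atTop N, eventually_ne_atTop 0] with m hm hm0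
  calc ‖T ^ m‖ ^ (1 / (m : ℝ)) ≤ (C * c ^ m) ^ (1 / (m : ℝ)) :=
        Real.rpow_le_rpow (norm_nonneg _) (h m hm) (by positivity)
    _ = C ^ (1 / (m : ℝ)) * c := by
        rw [Real.mul_rpow hC.le (by positivity), one_div,
          Real.pow_rpow_inv_natCast hc.le hm0]

/-- If c^n < m(T^n), then iterating the lower bound gives ‖T^(nk)‖ ≥ c^(nk) for all k; Gelfand's
formula along the multiples of n concludes. -/
theorem innerRadius_le_outerRadius [Nontrivial H] (T : H →L[ℂ] H) :
    innerRadius T ≤ outerRadius T := by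
  refine le_of_forall_lt_imp_le_of_dense fun c hc => ?_
  rcases lt_or_ge c 0 with hc0 | hc0
  · exact hc0.le.trans (outerRadius_nonneg T)
  obtain ⟨n, hn, hcn⟩ := exists_pow_lt_lowerBound_of_lt_innerRadius hc0 hc
  have hmul : Tendsto (fun k : ℕ => n * k) atTop atTop :=
    tendsto_id.const_mul_atTop' (by omega)
  refine ge_of_tendsto ((tendsto_norm_pow_rpow_outerRadius T).comp hmul) ?_
  filter_upwards [eventually_ne_atTop 0] with k hk
  have hnk : n * k ≠ 0 := mul_ne_zero (by omega) hk
  have h1 : c ^ (n * k) ≤ ‖T ^ (n * k)‖ := by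
    rw [pow_mul, pow_mul]
    refine (pow_le_pow_left₀ (by positivity) hcn.le k).trans ?_
    refine (le_lowerBound fun x => lowerBound_pow_mul_norm_le (T ^ n) k x).trans
      (lowerBound_le_norm _)
  calc c = (c ^ (n * k)) ^ (1 / ((n * k : ℕ) : ℝ)) := by
        rw [one_div, Real.pow_rpow_inv_natCast hc0 hnk]
    _ ≤ _ := Real.rpow_le_rpow (by positivity) h1 (by positivity)

theorem exists_leftInverse_of_outerRadius_lt {T : H →L[ℂ] H} {z : ℂ} (hz : outerRadius T < ‖z‖) :
    ∃ L : H →L[ℂ] H, ∀ x, L (T x - z • x) = x := by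
  have h1 : spectralRadius ℂ T < ‖z‖₊ := by
    rw [← ENNReal.ofReal_toReal (spectralRadius_ne_top T), ← enorm_eq_nnnorm,
      ← ofReal_norm]
    exact (ENNReal.ofReal_lt_ofReal_iff_of_nonneg ENNReal.toReal_nonneg).mpr hz
  obtain ⟨u, hu⟩ := spectrum.mem_resolventSet_of_spectralRadius_lt h1
  -- The unit u is z - T, whence the sign.
  refine ⟨-(↑u⁻¹ : H →L[ℂ] H), fun x => ?_⟩
  have h2 : T x - z • x = -((u : H →L[ℂ] H) x) := by
    rw [hu]
    simp [Algebra.algebraMap_eq_smul_one]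
  rw [h2, map_neg, neg_apply, neg_neg]
  exact DFunLike.congr_fun u.inv_mul x

end Radii

/-! ### Property (β) off the critical circle -/

section BetaAt

variable {H : Type*} [NormedAddCommGroup H] [InnerProductSpace ℂ H] [CompleteSpace H]

theorem hasBishopBetaAt_of_outerRadius_lt {T : H →L[ℂ] H} {z : ℂ} (hz : outerRadius T < ‖z‖) :
    HasBishopBetaAt T z :=
  ⟨⟨{w | outerRadius T < ‖w‖}, isOpen_lt continuous_const continuous_norm⟩, hz, fun _ hU =>
    injective_and_isClosed_range_of_leftInverse fun _ hw =>
      exists_leftInverse_of_outerRadius_lt (hU hw)⟩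

theorem hasBishopBetaAt_of_lt_innerRadius {T : H →L[ℂ] H} {z : ℂ} (hz : ‖z‖ < innerRadius T) :
    HasBishopBetaAt T z :=
  ⟨⟨{w | ‖w‖ < innerRadius T}, isOpen_lt continuous_norm continuous_const⟩, hz, fun _ hU =>
    injective_and_isClosed_range_of_leftInverse fun _ hw => by
      obtain ⟨c, hc, h⟩ := exists_bound_of_lt_innerRadius (hU hw)
      exact exists_leftInverse_of_bound hc h⟩

end BetaAt

/-! ### Coordinates, powers and rotations of the shift -/

/-- The products `ω 0 * ⋯ * ω (n - 1)` of the weights of a shift. -/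
def weightProd (ω : ℕ → ℝ) (n : ℕ) : ℝ := ∏ i ∈ Finset.range n, ω i

theorem weightProd_succ (ω : ℕ → ℝ) (n : ℕ) : weightProd ω (n + 1) = weightProd ω n * ω n :=
  Finset.prod_range_succ _ _

theorem HilbertBasis.hasSum_sq_norm_repr {ι H : Type*} [NormedAddCommGroup H]
    [InnerProductSpace ℂ H] (e : HilbertBasis ι ℂ H) (x : H) :
    HasSum (fun i => ‖e.repr x i‖ ^ 2) (‖x‖ ^ 2) := by
  have h := lp.hasSum_norm (p := 2) (by norm_num) (e.repr x)
  simpa [e.repr.norm_map] using h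

namespace IsUnilateralWeightedShift

variable {H : Type*} [NormedAddCommGroup H] [InnerProductSpace ℂ H]
  {e : HilbertBasis ℕ ℂ H} {ω : ℕ → ℝ} {S : H →L[ℂ] H}

theorem weightProd_pos (hS : IsUnilateralWeightedShift e ω S) (n : ℕ) : 0 < weightProd ω n :=
  Finset.prod_pos fun i _ => hS.weight_pos i

theorem hasSum_repr_apply (hS : IsUnilateralWeightedShift e ω S) (x : H) (k : ℕ) :
    HasSum (fun i => if k = i + 1 then (ω i : ℂ) * e.repr x i else 0) (e.repr (S x) k) := by
  have h := ((e.hasSum_repr x).mapL S).mapL (innerSL ℂ (e k))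
  rw [innerSL_apply_apply, ← e.repr_apply_apply] at h
  refine h.congr_fun fun i => ?_
  rw [map_smul, hS.apply_basis, innerSL_apply_apply, inner_smul_right, inner_smul_right,
    orthonormal_iff_ite.mp e.orthonormal]
  split_ifs <;> ring

theorem repr_apply_zero (hS : IsUnilateralWeightedShift e ω S) (x : H) : e.repr (S x) 0 = 0 :=
  (hS.hasSum_repr_apply x 0).unique (by simp)

theorem repr_apply_succ (hS : IsUnilateralWeightedShift e ω S) (x : H) (k : ℕ) :
    e.repr (S x) (k + 1) = ω k * e.repr x k := by
  refine (hS.hasSum_repr_apply x (k + 1)).unique ?_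
  have h := hasSum_single (f := fun i => if k + 1 = i + 1 then (ω i : ℂ) * e.repr x i else 0) k
    (fun i hi => if_neg (by omega))
  simpa using h

theorem repr_pow_apply_of_lt (hS : IsUnilateralWeightedShift e ω S) (x : H) {m j : ℕ}
    (hj : j < m) : e.repr ((S ^ m) x) j = 0 := by
  induction m generalizing j with
  | zero => omega
  | succ m ih =>
    rw [pow_succ']
    change e.repr (S ((S ^ m) x)) j = 0
    cases j with
    | zero => exact hS.repr_apply_zero _
    | succ j => rw [hS.repr_apply_succ, ih (by omega), mul_zero]

theorem repr_pow_apply_add (hS : IsUnilateralWeightedShift e ω S) (x : H) (m k : ℕ) :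
    e.repr ((S ^ m) x) (k + m) = (weightProd ω (k + m) / weightProd ω k : ℝ) * e.repr x k := by
  induction m with
  | zero =>
    have := (hS.weightProd_pos k).ne'
    simp [this]
  | succ m ih =>
    rw [pow_succ']
    change e.repr (S ((S ^ m) x)) (k + m + 1) = _
    rw [hS.repr_apply_succ, ih, ← add_assoc, weightProd_succ]
    push_cast
    ring

/-- Parseval, the first m coordinates of S^m x being zero. Uniform bounds on the ratios thus become
bounds on ‖S^m x‖. -/
theorem hasSum_sq_norm_pow_apply (hS : IsUnilateralWeightedShift e ω S) (x : H) (m : ℕ) :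
    HasSum (fun k => (weightProd ω (k + m) / weightProd ω k * ‖e.repr x k‖) ^ 2)
      (‖(S ^ m) x‖ ^ 2) := by
  have h := (hasSum_nat_add_iff' m).mpr (e.hasSum_sq_norm_repr ((S ^ m) x))
  rw [Finset.sum_eq_zero, sub_zero] at h
  · refine h.congr_fun fun k => ?_
    rw [hS.repr_pow_apply_add, norm_mul, Complex.norm_real, Real.norm_of_nonneg
      (div_nonneg (hS.weightProd_pos _).le (hS.weightProd_pos _).le)]
  · intro i hi
    rw [hS.repr_pow_apply_of_lt x (Finset.mem_range.mp hi)]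
    simp

theorem norm_pow_le (hS : IsUnilateralWeightedShift e ω S) {m : ℕ} {C : ℝ} (hC : 0 ≤ C)
    (h : ∀ k, weightProd ω (k + m) ≤ C * weightProd ω k) : ‖S ^ m‖ ≤ C := by
  refine ContinuousLinearMap.opNorm_le_bound _ hC fun x => ?_
  refine le_of_sq_le_sq ?_ (by positivity)
  rw [mul_pow]
  refine hasSum_le (fun k => ?_) (hS.hasSum_sq_norm_pow_apply x m)
    ((e.hasSum_sq_norm_repr x).mul_left (C ^ 2))
  rw [← mul_pow]
  have := hS.weightProd_pos k
  have := hS.weightProd_pos (k + m)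
  have h1 : weightProd ω (k + m) / weightProd ω k ≤ C := (div_le_iff₀ (by positivity)).mpr (h k)
  gcongr

theorem le_norm_pow_apply (hS : IsUnilateralWeightedShift e ω S) {m : ℕ} {c : ℝ} (hc : 0 ≤ c)
    (h : ∀ k, c * weightProd ω k ≤ weightProd ω (k + m)) (x : H) :
    c * ‖x‖ ≤ ‖(S ^ m) x‖ := by
  refine le_of_sq_le_sq ?_ (by positivity)
  rw [mul_pow]
  refine hasSum_le (fun k => ?_) ((e.hasSum_sq_norm_repr x).mul_left (c ^ 2))
    (hS.hasSum_sq_norm_pow_apply x m)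
  rw [← mul_pow]
  have := hS.weightProd_pos k
  have h1 : c ≤ weightProd ω (k + m) / weightProd ω k := (le_div_iff₀ (by positivity)).mpr (h k)
  gcongr

/-- If the first `N` coordinates of `(S - z) x` vanish and `z ≠ 0`, then so do those of `x`. -/
theorem repr_eq_zero_of_lt (hS : IsUnilateralWeightedShift e ω S) {z : ℂ} (hz : z ≠ 0) {x : H}
    {N : ℕ} (h : ∀ k < N, e.repr (S x - z • x) k = 0) {k : ℕ} (hk : k < N) : e.repr x k = 0 := by
  have hcoord : ∀ k, e.repr (S x - z • x) k = e.repr (S x) k - z * e.repr x k := fun k => by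
    rw [map_sub, map_smul]
    rfl
  -- The coordinates of (S - z) x are -z x_0 and ω_k x_k - z x_{k+1}, so vanishing propagates
  -- upwards.
  induction k with
  | zero =>
    have := h 0 hk
    rw [hcoord, hS.repr_apply_zero, zero_sub, neg_eq_zero] at this
    exact (mul_eq_zero.mp this).resolve_left hz
  | succ k ih =>
    have := h (k + 1) hk
    rw [hcoord, hS.repr_apply_succ, ih (by omega), mul_zero, zero_sub, neg_eq_zero] at this
    exact (mul_eq_zero.mp this).resolve_left hz

/-- A unilateral weighted shift has no eigenvalues. -/
theorem eq_zero_of_apply_eq_smul (hS : IsUnilateralWeightedShift e ω S) (z : ℂ) (x : H)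
    (h : S x = z • x) : x = 0 := by
  refine (LinearIsometryEquiv.map_eq_zero_iff e.repr).mp ?_
  ext k
  change e.repr x k = 0
  rcases eq_or_ne z 0 with rfl | hz
  · rw [zero_smul] at h
    have h1 := hS.repr_apply_succ x k
    rw [h, map_zero] at h1
    exact (mul_eq_zero.mp h1.symm).resolve_left
      (Complex.ofReal_ne_zero.mpr (hS.weight_pos k).ne')
  · refine hS.repr_eq_zero_of_lt hz (N := k + 1) (fun j _ => ?_) (Nat.lt_succ_self k)
    rw [h, sub_self, map_zero]
    rfl

variable [CompleteSpace H]

/-- A unilateral weighted shift is unitarily equivalent to its rotations. -/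
theorem exists_rotation (hS : IsUnilateralWeightedShift e ω S) {w : ℂ} (hw : ‖w‖ = 1) :
    ∃ W : H ≃L[ℂ] H, ∀ x, W (S x) = w • S (W x) := by
  have hw0 : w ≠ 0 := by
    rintro rfl
    simp at hw
  -- W is the unitary with W e_n = w^n e_n; both W S and w S W send e_n to ω_n w^(n+1) e_{n+1}.
  let v : ℕ → H := fun n => w ^ n • e n
  have hv : Orthonormal ℂ v := by
    refine ⟨fun n => ?_, fun i j hij => ?_⟩
    · simp [v, norm_smul, hw, e.orthonormal.1 n]
    · simp [v, inner_smul_left, inner_smul_right, e.orthonormal.2 hij]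
  have hspan : ⊤ ≤ (Submodule.span ℂ (Set.range v)).topologicalClosure := by
    rw [← e.dense_span]
    refine Submodule.topologicalClosure_mono (Submodule.span_le.mpr ?_)
    rintro _ ⟨n, rfl⟩
    have h1 : e n = (w ^ n)⁻¹ • v n := (inv_smul_smul₀ (pow_ne_zero n hw0) _).symm
    rw [h1]
    exact Submodule.smul_mem _ _ (Submodule.subset_span ⟨n, rfl⟩)
  let e' := HilbertBasis.mk hv hspan
  let W := (e.repr.trans e'.repr.symm).toContinuousLinearEquiv
  have hW : ∀ n, W (e n) = w ^ n • e n := by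
    intro n
    change e'.repr.symm (e.repr (e n)) = _
    rw [e.repr_self, e'.repr_symm_single, HilbertBasis.coe_mk]
  refine ⟨W, fun x => ?_⟩
  have hext : (W : H →L[ℂ] H) ∘L S = w • (S ∘L (W : H →L[ℂ] H)) := by
    refine ContinuousLinearMap.ext_on (s := Set.range e) ?_ ?_
    · rw [Submodule.dense_iff_topologicalClosure_eq_top]
      exact e.dense_span
    · rintro _ ⟨n, rfl⟩
      change W (S (e n)) = w • S (W (e n))
      rw [hS.apply_basis, map_smul, hW, hW, map_smul, hS.apply_basis, smul_smul, smul_smul,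
        smul_smul, pow_succ]
      congr 1
      ring
  exact DFunLike.congr_fun hext x

theorem hasBishopBetaAt_of_norm_eq (hS : IsUnilateralWeightedShift e ω S) {z z' : ℂ}
    (hzz' : ‖z‖ = ‖z'‖) (h : HasBishopBetaAt S z) : HasBishopBetaAt S z' := by
  rcases eq_or_ne z 0 with rfl | hz
  · have : z' = 0 := by simpa using hzz'.symm
    rwa [this]
  have hw : ‖z' / z‖ = 1 := by
    rw [norm_div, ← hzz', div_self (norm_ne_zero_iff.mpr hz)]
  obtain ⟨W, hW⟩ := hS.exists_rotation hw
  have hw0 : z' / z ≠ 0 := norm_ne_zero_iff.mp (by rw [hw]; exact one_ne_zero)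
  have := h.mul_left hS.eq_zero_of_apply_eq_smul hw0 W hW
  rwa [div_mul_cancel₀ _ hz] at this

theorem hasBishopBeta_or_sigmaBeta_eq (hS : IsUnilateralWeightedShift e ω S)
    (hr : innerRadius S = outerRadius S) :
    HasBishopBeta S ∨ sigmaBeta S = {z : ℂ | ‖z‖ = outerRadius S} := by
  have hoff : ∀ z : ℂ, ‖z‖ ≠ outerRadius S → HasBishopBetaAt S z := fun z hz => by
    rcases lt_or_gt_of_ne hz with h | h
    · exact hasBishopBetaAt_of_lt_innerRadius (hr ▸ h)
    · exact hasBishopBetaAt_of_outerRadius_lt h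
  by_cases h : ∃ z : ℂ, ‖z‖ = outerRadius S ∧ HasBishopBetaAt S z
  · obtain ⟨z, hz, hβ⟩ := h
    left
    refine hasBishopBeta_of_forall_hasBishopBetaAt hS.eq_zero_of_apply_eq_smul fun z' => ?_
    by_cases hz' : ‖z'‖ = outerRadius S
    · exact hS.hasBishopBetaAt_of_norm_eq (hz.trans hz'.symm) hβ
    · exact hoff z' hz'
  · right
    ext z
    exact ⟨fun hz => by_contra fun hne => hz (hoff z hne), fun hz hβ => h ⟨z, hz, hβ⟩⟩

end IsUnilateralWeightedShift

/-! ### Growth, decay and peaks of the weight products -/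

/-- A positive sequence which does not increase over long steps far out is dominated, up to a
constant, by each of its earlier values. -/
theorem exists_forall_add_le_mul {h : ℕ → ℝ} (hpos : ∀ k, 0 < h k) {N : ℕ}
    (hN : ∀ a ≥ N, ∀ k ≥ a + N, h k ≤ h a) :
    ∃ C > 0, ∀ m ≥ 2 * N, ∀ k, h (k + m) ≤ C * h k := by
  have hnn : ∀ i ∈ Finset.range N, 0 ≤ h N / h i := fun i _ =>
    div_nonneg (hpos N).le (hpos i).le
  -- The 1 serves k ≥ N. For k < N, k + m ≥ 2N allows comparison with h N, and the sum dominates h N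
  -- / h k.
  refine ⟨1 + ∑ i ∈ Finset.range N, h N / h i,
    add_pos_of_pos_of_nonneg one_pos (Finset.sum_nonneg hnn), fun m hm k => ?_⟩
  rw [← div_le_iff₀ (hpos k)]
  rcases le_or_gt N k with hk | hk
  · have h1 : h (k + m) / h k ≤ 1 := (div_le_one (hpos k)).mpr (hN k hk _ (by omega))
    linarith [Finset.sum_nonneg hnn]
  · have h1 : h (k + m) / h k ≤ h N / h k :=
      div_le_div_of_nonneg_right (hN N le_rfl _ (by omega)) (hpos k).le
    linarith [Finset.single_le_sum hnn (Finset.mem_range.mpr hk)]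

/-- Passing from rate X to M ≤ X multiplies the k-th term by (X / M)^k, which is nondecreasing in k.
-/
theorem div_pow_le_div_pow_of_le {β : ℕ → ℝ} (hβ : ∀ k, 0 < β k) {X M : ℝ} (hM : 0 < M)
    (hMX : M ≤ X) {a p : ℕ} (hap : a ≤ p) (h : β a / X ^ a ≤ β p / X ^ p) :
    β a / M ^ a ≤ β p / M ^ p := by
  have hX : 0 < X := hM.trans_le hMX
  have key : ∀ k, β k / M ^ k = β k / X ^ k * (X / M) ^ k := fun k => by
    rw [div_pow]
    field_simp
  rw [key a, key p]
  have h1 : 1 ≤ X / M := (one_le_div hM).mpr hMX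
  have h2 := hβ p
  exact mul_le_mul h (pow_le_pow_right₀ h1 hap) (by positivity) (by positivity)

theorem div_pow_le_div_pow_of_ge {β : ℕ → ℝ} (hβ : ∀ k, 0 < β k) {Y M : ℝ} (hY : 0 < Y)
    (hYM : Y ≤ M) {q b : ℕ} (hqb : q ≤ b) (h : β b / Y ^ b ≤ β q / Y ^ q) :
    β b / M ^ b ≤ β q / M ^ q := by
  have hM : 0 < M := hY.trans_le hYM
  have key : ∀ k, β k / M ^ k = β k / Y ^ k * (Y / M) ^ k := fun k => by
    rw [div_pow]
    field_simp
  rw [key b, key q]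
  have h1 : Y / M ≤ 1 := (div_le_one hM).mpr hYM
  have h2 := hβ q
  exact mul_le_mul h (pow_le_pow_of_le_one (by positivity) h1 hqb) (by positivity)
    (by positivity)

/-- `HasPeaks β u v`: arbitrarily far out the positive sequence `β` has long stretches `[a, p]` of
growth at average rate at least `u` followed immediately by long stretches `[p, b]` of growth at
average rate at most `v`. -/
def HasPeaks (β : ℕ → ℝ) (u v : ℝ) : Prop :=
  ∀ N : ℕ, ∃ a p b : ℕ, N ≤ a ∧ a + N ≤ p ∧ p + N ≤ b ∧
    β a / u ^ a ≤ β p / u ^ p ∧ β b / v ^ b ≤ β p / v ^ p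

/-- If `β` has long stretches of growth rate at least `X` and long stretches of growth rate at most
`Y < X` arbitrarily far out, then for any intermediate rate `M` it has peaks for `(X, M)` or
for `(M, Y)`. -/
theorem hasPeaks_or_hasPeaks {β : ℕ → ℝ} (hβ : ∀ k, 0 < β k) {X M Y : ℝ} (hY : 0 < Y)
    (hYM : Y ≤ M) (hMX : M ≤ X)
    (hup : ∀ N : ℕ, ∃ a ≥ N, ∃ k ≥ a + N, β a / X ^ a ≤ β k / X ^ k)
    (hdown : ∀ N : ℕ, ∃ j ≥ N, ∃ b ≥ j + N, β b / Y ^ b ≤ β j / Y ^ j) :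
    HasPeaks β X M ∨ HasPeaks β M Y := by
  have key : ∀ N : ℕ, ∃ a p b : ℕ, N ≤ a ∧ a + N ≤ p ∧ p + N ≤ b ∧
      ((β a / X ^ a ≤ β p / X ^ p ∧ β b / M ^ b ≤ β p / M ^ p) ∨
        (β a / M ^ a ≤ β p / M ^ p ∧ β b / Y ^ b ≤ β p / Y ^ p)) := by
    intro N
    obtain ⟨a, ha, k, hk, hak⟩ := hup N
    -- The decay stretch is taken beyond the growth stretch, so a < b with room for the peak in
    -- between.
    obtain ⟨j, hj, b, hb, hjb⟩ := hdown (max N k)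
    have hkj : k ≤ j := (le_max_right N k).trans hj
    have hNm : N ≤ max N k := le_max_left N k
    -- What matters below is only k ≤ p ≤ q ≤ j, `hap` and `hqb`; the maximisers are one choice.
    obtain ⟨p, hp, hpmax⟩ := Finset.exists_max_image (Finset.Icc k j) (fun i => β i / X ^ i)
      ⟨k, Finset.mem_Icc.mpr ⟨le_rfl, hkj⟩⟩
    obtain ⟨hkp, hpj⟩ := Finset.mem_Icc.mp hp
    obtain ⟨q, hq, hqmax⟩ := Finset.exists_max_image (Finset.Icc p j) (fun i => β i / Y ^ i)
      ⟨p, Finset.mem_Icc.mpr ⟨le_rfl, hpj⟩⟩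
    obtain ⟨hpq, hqj⟩ := Finset.mem_Icc.mp hq
    have hap : β a / X ^ a ≤ β p / X ^ p :=
      hak.trans (hpmax k (Finset.mem_Icc.mpr ⟨le_rfl, hkj⟩))
    have hqb : β b / Y ^ b ≤ β q / Y ^ q :=
      hjb.trans (hqmax j (Finset.mem_Icc.mpr ⟨hpj, le_rfl⟩))
    -- The middle stretch [p, q] has average rate at most M or at least M. It is joined to the decay
    -- or to the growth stretch, whose rate is weakened to M.
    rcases le_total (β q / M ^ q) (β p / M ^ p) with h | h
    · exact ⟨a, p, b, ha, by omega, by omega, Or.inl ⟨hap,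
        (div_pow_le_div_pow_of_ge hβ hY hYM (by omega) hqb).trans h⟩⟩
    · exact ⟨a, q, b, ha, by omega, by omega, Or.inr ⟨
        (div_pow_le_div_pow_of_le hβ (hY.trans_le hYM) hMX (by omega) hap).trans h, hqb⟩⟩
  -- The requirement for N implies that for every smaller N, so if each kind of peak failed at some
  -- N, neither would exist at the maximum.
  by_contra! hcon
  obtain ⟨h1, h2⟩ := hcon
  rw [HasPeaks, not_forall] at h1 h2
  obtain ⟨N₁, h1⟩ := h1
  obtain ⟨N₂, h2⟩ := h2
  obtain ⟨a, p, b, ha, hp, hb, h⟩ := key (max N₁ N₂)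
  have hm1 : N₁ ≤ max N₁ N₂ := le_max_left _ _
  have hm2 : N₂ ≤ max N₁ N₂ := le_max_right _ _
  rcases h with h | h
  · exact h1 ⟨a, p, b, by omega, by omega, by omega, h⟩
  · exact h2 ⟨a, p, b, by omega, by omega, by omega, h⟩

namespace IsUnilateralWeightedShift

variable {H : Type*} [NormedAddCommGroup H] [InnerProductSpace ℂ H]
  {e : HilbertBasis ℕ ℂ H} {ω : ℕ → ℝ} {S : H →L[ℂ] H}

theorem nontrivial (e : HilbertBasis ℕ ℂ H) : Nontrivial H :=
  ⟨⟨e 0, 0, e.orthonormal.ne_zero 0⟩⟩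

/-- Otherwise Y^k / β_k does not increase over long steps far out, which gives β_{k+m} ≥ C⁻¹ Y^m β_k
for all k and all large m, hence Y ≤ r₁(S). -/
theorem exists_decay (hS : IsUnilateralWeightedShift e ω S) {Y : ℝ} (hY : 0 < Y)
    (hr : innerRadius S < Y) (N : ℕ) : ∃ j ≥ N, ∃ b ≥ j + N,
      weightProd ω b / Y ^ b ≤ weightProd ω j / Y ^ j := by
  have := nontrivial e
  by_contra! hcon
  have hpos : ∀ k, 0 < weightProd ω k / Y ^ k := fun k =>
    div_pos (hS.weightProd_pos k) (by positivity)
  obtain ⟨C, hC, h⟩ := exists_forall_add_le_mul (h := fun k => (weightProd ω k / Y ^ k)⁻¹)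
    (fun k => inv_pos.mpr (hpos k))
    (fun a ha k hk => inv_anti₀ (hpos a) (hcon a ha k hk).le)
  refine hr.not_ge (le_innerRadius_of_bound hY (inv_pos.mpr hC) (N := 2 * N) fun m hm => ?_)
  refine hS.le_norm_pow_apply (by positivity) fun k => ?_
  have h1 := h m hm k
  have hk := hS.weightProd_pos k
  have hkm := hS.weightProd_pos (k + m)
  rw [inv_div, inv_div, ← mul_div_assoc, div_le_div_iff₀ hkm hk, pow_add] at h1
  have h2 : 0 < Y ^ k := by positivity
  rw [mul_assoc, inv_mul_le_iff₀ hC]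
  refine le_of_mul_le_mul_left ?_ h2
  linarith

variable [CompleteSpace H]

/-- Otherwise β_{k+m} ≤ C X^m β_k for all k and all large m, hence r(S) ≤ X. -/
theorem exists_growth (hS : IsUnilateralWeightedShift e ω S) {X : ℝ} (hX : 0 < X)
    (hr : X < outerRadius S) (N : ℕ) : ∃ a ≥ N, ∃ k ≥ a + N,
      weightProd ω a / X ^ a ≤ weightProd ω k / X ^ k := by
  by_contra! hcon
  obtain ⟨C, hC, h⟩ := exists_forall_add_le_mul (h := fun k => weightProd ω k / X ^ k)
    (fun k => div_pos (hS.weightProd_pos k) (by positivity))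
    (fun a ha k hk => (hcon a ha k hk).le)
  refine hr.not_ge (outerRadius_le_of_bound hX hC (N := 2 * N) fun m hm => ?_)
  refine hS.norm_pow_le (by positivity) fun k => ?_
  have h1 := h m hm k
  rw [div_le_iff₀ (by positivity), pow_add] at h1
  refine h1.trans_eq ?_
  field_simp

end IsUnilateralWeightedShift

/-- Disjoint peaks with p = a + s and b = a + s + t. Both arms have length at least j, which makes
the errors below summable. -/
theorem HasPeaks.exists_seq {β : ℕ → ℝ} {u v : ℝ} (h : HasPeaks β u v) :
    ∃ a s t : ℕ → ℕ, (∀ j, j ≤ s j ∧ j ≤ t j ∧ 0 < t j ∧ a j + s j + t j < a (j + 1)) ∧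
      ∀ j, β (a j) / u ^ a j ≤ β (a j + s j) / u ^ (a j + s j) ∧
        β (a j + s j + t j) / v ^ (a j + s j + t j) ≤ β (a j + s j) / v ^ (a j + s j) := by
  have h' : ∀ N : ℕ, ∃ a s t : ℕ, N ≤ a ∧ N ≤ s ∧ N ≤ t ∧
      β a / u ^ a ≤ β (a + s) / u ^ (a + s) ∧
        β (a + s + t) / v ^ (a + s + t) ≤ β (a + s) / v ^ (a + s) := by
    intro N
    obtain ⟨a, p, b, ha, hp, hb, hu, hv⟩ := h N
    obtain ⟨s, rfl⟩ := Nat.exists_eq_add_of_le (show a ≤ p by omega)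
    obtain ⟨t, rfl⟩ := Nat.exists_eq_add_of_le (show a + s ≤ b by omega)
    exact ⟨a, s, t, ha, by omega, by omega, hu, hv⟩
  choose a s t ha hs ht hu hv using h'
  -- Each threshold lies one past the end of the previous block; starting at 1 forces t > 0.
  let N : ℕ → ℕ := fun j => Nat.rec 1 (fun _ n => a n + s n + t n + 1) j
  have hN : ∀ j, N (j + 1) = a (N j) + s (N j) + t (N j) + 1 := fun j => rfl
  have hNj : ∀ j, j + 1 ≤ N j := by
    intro j
    induction j with
    | zero => exact le_rfl
    | succ j ih =>
      rw [hN]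
      have := ha (N j)
      omega
  refine ⟨fun j => a (N j), fun j => s (N j), fun j => t (N j), fun j => ?_,
    fun j => ⟨hu _, hv _⟩⟩
  have h1 := hs (N j)
  have h2 := ht (N j)
  have h3 := hNj j
  have h4 := ha (N (j + 1))
  rw [hN] at h4
  change j ≤ s (N j) ∧ j ≤ t (N j) ∧ 0 < t (N j) ∧ a (N j) + s (N j) + t (N j) < a (N (j + 1))
  rw [hN]
  omega

/-! ### Truncated formal eigenvectors -/

section ShiftBlock

variable {H : Type*} [NormedAddCommGroup H] [InnerProductSpace ℂ H]

/-- The vector-valued Laurent polynomial `∑_{a ≤ k < b} (β k / β p) z ^ (p - k) e_k`. -/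
noncomputable def shiftBlock (e : HilbertBasis ℕ ℂ H) (β : ℕ → ℝ) (a p b : ℕ) (z : ℂ) : H :=
  ∑ k ∈ Finset.Ico a b, (((β k / β p : ℝ) : ℂ) * z ^ ((p : ℤ) - k)) • e k

theorem analyticAt_shiftBlock (e : HilbertBasis ℕ ℂ H) (β : ℕ → ℝ) (a p b : ℕ) {z : ℂ}
    (hz : z ≠ 0) : AnalyticAt ℂ (shiftBlock e β a p b) z := by
  refine Finset.analyticAt_fun_sum _ fun k _ => ?_
  exact (analyticAt_const.mul (analyticAt_id.fun_zpow hz)).smul analyticAt_const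

theorem repr_shiftBlock (e : HilbertBasis ℕ ℂ H) (β : ℕ → ℝ) (a p b : ℕ) (z : ℂ) (n : ℕ) :
    e.repr (shiftBlock e β a p b z) n =
      if n ∈ Finset.Ico a b then ((β n / β p : ℝ) : ℂ) * z ^ ((p : ℤ) - n) else 0 := by
  rw [e.repr_apply_apply, shiftBlock, inner_sum]
  simp_rw [inner_smul_right, orthonormal_iff_ite.mp e.orthonormal, mul_ite, mul_one, mul_zero]
  rw [Finset.sum_ite_eq]

/-- The sum telescopes: S sends the k-th summand to the multiple of e_{k+1} that z times the next
summand cancels. -/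
theorem IsUnilateralWeightedShift.apply_shiftBlock_sub {e : HilbertBasis ℕ ℂ H} {ω : ℕ → ℝ}
    {S : H →L[ℂ] H} (hS : IsUnilateralWeightedShift e ω S) {a p b : ℕ} (hab : a ≤ b) {z : ℂ}
    (hz : z ≠ 0) :
    S (shiftBlock e (weightProd ω) a p b z) - z • shiftBlock e (weightProd ω) a p b z =
      (((weightProd ω b / weightProd ω p : ℝ) : ℂ) * z ^ ((p : ℤ) + 1 - b)) • e b -
        (((weightProd ω a / weightProd ω p : ℝ) : ℂ) * z ^ ((p : ℤ) + 1 - a)) • e a := by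
  rw [← Finset.sum_Ico_sub (fun k => (((weightProd ω k / weightProd ω p : ℝ) : ℂ) *
    z ^ ((p : ℤ) + 1 - k)) • e k) hab, shiftBlock, map_sum, Finset.smul_sum,
    ← Finset.sum_sub_distrib]
  refine Finset.sum_congr rfl fun k _ => ?_
  rw [map_smul, hS.apply_basis, smul_smul, smul_smul, weightProd_succ]
  have h1 : (p : ℤ) + 1 - (k + 1 : ℕ) = p - k := by push_cast; ring
  have h2 : (p : ℤ) + 1 - k = p - k + 1 := by ring
  rw [h1, h2, zpow_add_one₀ hz]
  congr 2
  · push_cast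
    ring
  · ring

/-- The end terms have norm at most |z| (v/|z|)^t and |z| (|z|/u)^s, by slow growth after the peak
and fast growth before it. -/
theorem IsUnilateralWeightedShift.norm_apply_shiftBlock_sub_le {e : HilbertBasis ℕ ℂ H}
    {ω : ℕ → ℝ} {S : H →L[ℂ] H} (hS : IsUnilateralWeightedShift e ω S) {u v ρ₁ ρ₂ : ℝ}
    (hv : 0 < v) (hv1 : v ≤ ρ₁) (hu2 : ρ₂ ≤ u) {j a s t : ℕ} (hs : j ≤ s) (ht : j ≤ t)
    (hup : weightProd ω a / u ^ a ≤ weightProd ω (a + s) / u ^ (a + s))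
    (hdown : weightProd ω (a + s + t) / v ^ (a + s + t) ≤ weightProd ω (a + s) / v ^ (a + s))
    {z : ℂ} (hz1 : ρ₁ ≤ ‖z‖) (hz2 : ‖z‖ ≤ ρ₂) :
    ‖S (shiftBlock e (weightProd ω) a (a + s) (a + s + t) z) -
      z • shiftBlock e (weightProd ω) a (a + s) (a + s + t) z‖ ≤
        ρ₂ * ((v / ρ₁) ^ j + (ρ₂ / u) ^ j) := by
  have hz : 0 < ‖z‖ := hv.trans_le (hv1.trans hz1)
  have hρ1 : 0 < ρ₁ := hv.trans_le hv1
  have hρ2 : 0 < ρ₂ := hz.trans_le hz2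
  have hu : 0 < u := hρ2.trans_le hu2
  have hz0 : z ≠ 0 := norm_pos_iff.mp hz
  have ha := hS.weightProd_pos a
  have hp := hS.weightProd_pos (a + s)
  have hb := hS.weightProd_pos (a + s + t)
  rw [hS.apply_shiftBlock_sub (by omega) hz0]
  refine (norm_sub_le _ _).trans ?_
  rw [norm_smul, norm_smul, e.orthonormal.1, e.orthonormal.1, mul_one, mul_one, norm_mul, norm_mul,
    Complex.norm_real, Complex.norm_real, Real.norm_of_nonneg (by positivity),
    Real.norm_of_nonneg (by positivity), mul_add, norm_zpow, norm_zpow]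
  have e1 : ((a + s : ℕ) : ℤ) + 1 - (a + s + t : ℕ) = 1 - (t : ℕ) := by push_cast; ring
  have e2 : ((a + s : ℕ) : ℤ) + 1 - a = ((s + 1 : ℕ) : ℤ) := by push_cast; ring
  rw [e1, e2, zpow_sub₀ hz.ne', zpow_one, zpow_natCast, zpow_natCast]
  have h1 : weightProd ω (a + s + t) / weightProd ω (a + s) ≤ v ^ t := by
    rw [div_le_div_iff₀ (by positivity) (by positivity), pow_add v (a + s)] at hdown
    rw [div_le_iff₀ hp]
    have : 0 < v ^ (a + s) := by positivity
    refine le_of_mul_le_mul_right ?_ this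
    linarith
  have h2 : weightProd ω a / weightProd ω (a + s) ≤ (u ^ s)⁻¹ := by
    rw [div_le_div_iff₀ (by positivity) (by positivity), pow_add] at hup
    rw [div_le_iff₀ hp, ← div_eq_inv_mul, le_div_iff₀ (by positivity)]
    have : 0 < u ^ a := by positivity
    refine le_of_mul_le_mul_right ?_ this
    linarith
  refine add_le_add ?_ ?_
  · calc weightProd ω (a + s + t) / weightProd ω (a + s) * (‖z‖ / ‖z‖ ^ t)
        ≤ v ^ t * (‖z‖ / ‖z‖ ^ t) := by gcongr
      _ = ‖z‖ * (v / ‖z‖) ^ t := by rw [div_pow]; ring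
      _ ≤ ρ₂ * (v / ρ₁) ^ t := by gcongr
      _ ≤ ρ₂ * (v / ρ₁) ^ j := mul_le_mul_of_nonneg_left
          (pow_le_pow_of_le_one (by positivity) ((div_le_one hρ1).mpr hv1) ht) hρ2.le
  · calc weightProd ω a / weightProd ω (a + s) * ‖z‖ ^ (s + 1)
        ≤ (u ^ s)⁻¹ * ‖z‖ ^ (s + 1) := by gcongr
      _ = ‖z‖ * (‖z‖ / u) ^ s := by rw [div_pow, pow_succ]; ring
      _ ≤ ρ₂ * (ρ₂ / u) ^ s := by gcongr
      _ ≤ ρ₂ * (ρ₂ / u) ^ j := mul_le_mul_of_nonneg_left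
          (pow_le_pow_of_le_one (by positivity) ((div_le_one hu).mpr hu2) hs) hρ2.le

end ShiftBlock

/-! ### Failure of closed range, and the theorem -/

/-- Limits of locally uniformly convergent sequences `(T - z) F_n(z)` of analytic functions lie in
the closure of the range of `T_U`. -/
theorem exists_mem_closure_range_of_tendstoLocallyUniformlyOn {H : Type*} [NormedAddCommGroup H]
    [NormedSpace ℂ H] [CompleteSpace H] {T : H →L[ℂ] H} {U : TopologicalSpace.Opens ℂ}
    {F : ℕ → ℂ → H} {g : ℂ → H} (hF : ∀ n, AnalyticOnNhd ℂ (F n) (U : Set ℂ))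
    (hlim : TendstoLocallyUniformlyOn (fun n z => T (F n z) - z • F n z) g atTop (U : Set ℂ)) :
    ∃ G ∈ closure (Set.range (inducedMap T U)), ∀ z : U, G.1 z = g z := by
  have hTF : ∀ n, AnalyticOnNhd ℂ (fun z => T (F n z) - z • F n z) (U : Set ℂ) := fun n z hz =>
    ((T.analyticAt _).comp (hF n z hz)).sub (analyticAt_id.smul (hF n z hz))
  have hg : AnalyticOnNhd ℂ g (U : Set ℂ) :=
    (hlim.differentiableOn (Eventually.of_forall fun n => (hTF n).differentiableOn)
      U.isOpen).analyticOnNhd U.isOpen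
  let lift : ∀ f : ℂ → H, AnalyticOnNhd ℂ f (U : Set ℂ) → analyticFunctions U H := fun f hf =>
    ⟨⟨fun z : U => f z, continuousOn_iff_continuous_domRestrict.mp hf.continuousOn⟩,
      f, hf, fun z => rfl⟩
  refine ⟨lift g hg, ?_, fun z => rfl⟩
  refine mem_closure_of_tendsto (b := atTop) (f := fun n => lift _ (hTF n)) ?_
    (Eventually.of_forall fun n => mem_range_inducedMap_iff.mpr ⟨F n, hF n, fun z => rfl⟩)
  rw [tendsto_subtype_rng]
  have : LocallyCompactSpace U := U.isOpen.locallyCompactSpace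
  rw [ContinuousMap.tendsto_iff_tendstoLocallyUniformly]
  exact tendstoLocallyUniformlyOn_iff_tendstoLocallyUniformly_comp_coe.mp hlim

/-- If the products of the weights have peaks for rates `v < u`, then the range of `S_U` is not
closed for the annulus `U = {v < |z| < u}`. -/
theorem IsUnilateralWeightedShift.not_hasBishopBeta_of_hasPeaks {H : Type*}
    [NormedAddCommGroup H] [InnerProductSpace ℂ H] [CompleteSpace H] {e : HilbertBasis ℕ ℂ H}
    {ω : ℕ → ℝ} {S : H →L[ℂ] H} (hS : IsUnilateralWeightedShift e ω S) {u v : ℝ} (hv : 0 < v)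
    (hvu : v < u) (h : HasPeaks (weightProd ω) u v) : ¬ HasBishopBeta S := by
  intro hβ
  obtain ⟨a, s, t, hast, hpeak⟩ := h.exists_seq
  let U : TopologicalSpace.Opens ℂ := ⟨{z | v < ‖z‖ ∧ ‖z‖ < u},
    (isOpen_lt continuous_const continuous_norm).inter (isOpen_lt continuous_norm continuous_const)⟩
  have hU0 : ∀ z ∈ U, z ≠ 0 := fun z hz => norm_pos_iff.mp (hv.trans hz.1)
  let f : ℕ → ℂ → H := fun j => shiftBlock e (weightProd ω) (a j) (a j + s j) (a j + s j + t j)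
  let E : ℕ → ℂ → H := fun j z => S (f j z) - z • f j z
  have hbound : ∀ ρ₁ ρ₂, v < ρ₁ → ρ₂ < u → ∀ j, ∀ z ∈ {z : ℂ | ρ₁ < ‖z‖ ∧ ‖z‖ < ρ₂},
      ‖E j z‖ ≤ ρ₂ * ((v / ρ₁) ^ j + (ρ₂ / u) ^ j) := fun ρ₁ ρ₂ h1 h2 j z hz =>
    hS.norm_apply_shiftBlock_sub_le hv h1.le h2.le (hast j).1 (hast j).2.1 (hpeak j).1 (hpeak j).2
      hz.1.le hz.2.le
  have hloc : ∀ z ∈ U, ∃ ρ₁ ρ₂, v < ρ₁ ∧ ρ₁ < ‖z‖ ∧ ‖z‖ < ρ₂ ∧ ρ₂ < u := fun z hz => by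
    obtain ⟨ρ₁, h1, h1'⟩ := exists_between hz.1
    obtain ⟨ρ₂, h2, h2'⟩ := exists_between hz.2
    exact ⟨ρ₁, ρ₂, h1, h1', h2, h2'⟩
  have hsum : ∀ ρ₁ ρ₂, v < ρ₁ → 0 < ρ₂ → ρ₂ < u →
      Summable fun j : ℕ => ρ₂ * ((v / ρ₁) ^ j + (ρ₂ / u) ^ j) := fun ρ₁ ρ₂ h1 h2 h3 => by
    have hρ1 := hv.trans h1
    have hu := h2.trans h3
    exact ((summable_geometric_of_lt_one (by positivity) ((div_lt_one hρ1).mpr h1)).add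
      (summable_geometric_of_lt_one (by positivity) ((div_lt_one hu).mpr h3))).mul_left _
  have hlim : TendstoLocallyUniformlyOn (fun n z => ∑ j ∈ Finset.range n, E j z)
      (fun z => ∑' j, E j z) atTop (U : Set ℂ) := by
    intro V hV z hz
    obtain ⟨ρ₁, ρ₂, h1, h2, h3, h4⟩ := hloc z hz
    refine ⟨{z : ℂ | ρ₁ < ‖z‖ ∧ ‖z‖ < ρ₂}, mem_nhdsWithin_of_mem_nhds ?_, ?_⟩
    · exact ((isOpen_lt continuous_const continuous_norm).inter
        (isOpen_lt continuous_norm continuous_const)).mem_nhds ⟨h2, h3⟩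
    · exact tendstoUniformlyOn_tsum_nat (hsum ρ₁ ρ₂ h1 ((norm_nonneg z).trans_lt h3) h4)
        (hbound ρ₁ ρ₂ h1 h4) V hV
  have hsumE : ∀ (n : ℕ) (z : ℂ), ∑ j ∈ Finset.range n, E j z =
      S (∑ j ∈ Finset.range n, f j z) - z • ∑ j ∈ Finset.range n, f j z := fun n z => by
    rw [map_sum, Finset.smul_sum, ← Finset.sum_sub_distrib]
  obtain ⟨G, hG, hGE⟩ := exists_mem_closure_range_of_tendstoLocallyUniformlyOn (T := S) (U := U)
    (F := fun n z => ∑ j ∈ Finset.range n, f j z)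
    (fun n z hz => Finset.analyticAt_fun_sum _ fun j _ =>
      analyticAt_shiftBlock e _ _ _ _ (hU0 z hz))
    (by simpa only [hsumE] using hlim)
  rw [(hβ U).2.closure_eq] at hG
  obtain ⟨F, -, hF⟩ := mem_range_inducedMap_iff.mp hG
  -- A single point of the annulus suffices for the contradiction.
  obtain ⟨r, hvr, hru⟩ := exists_between hvu
  have hnr : ‖(r : ℂ)‖ = r := by
    rw [Complex.norm_real, Real.norm_of_nonneg (hv.trans hvr).le]
  have hzU : (r : ℂ) ∈ U := by
    change v < ‖(r : ℂ)‖ ∧ ‖(r : ℂ)‖ < u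
    rw [hnr]
    exact ⟨hvr, hru⟩
  have hz0 := hU0 _ hzU
  have haj : StrictMono a := strictMono_nat_of_lt_succ fun j => by
    have := (hast j).2.2.2
    omega
  have hEsum : Summable fun j => E j r := by
    obtain ⟨ρ₁, ρ₂, h1, h2, h3, h4⟩ := hloc _ hzU
    exact Summable.of_norm_bounded (hsum ρ₁ ρ₂ h1 ((norm_nonneg _).trans_lt h3) h4)
      fun j => hbound ρ₁ ρ₂ h1 h4 j _ ⟨h2, h3⟩
  -- Later blocks start strictly beyond the end of block i, so their end terms do not reach its
  -- coordinates.
  have hEzero : ∀ i j k, i + 1 ≤ j → k ≤ a i + s i + t i → e.repr (E j r) k = 0 := by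
    intro i j k hij hk
    have h1 := (hast i).2.2.2
    have h2 := haj.monotone hij
    change e.repr (S (shiftBlock e _ _ _ _ _) - _ • shiftBlock e _ _ _ _ _) k = 0
    rw [hS.apply_shiftBlock_sub (by omega) hz0, e.repr_apply_apply, inner_sub_right,
      inner_smul_right, inner_smul_right, e.orthonormal.2 (by omega), e.orthonormal.2 (by omega)]
    simp
  -- With y the sum of blocks 0, …, i at r, (S - r)(F r - y) is the tail of the series and vanishes
  -- on coordinates below the end of block i. So F r and y agree at the i-th peak, where only block
  -- i contributes, with value 1.
  have hone : ∀ i, e.repr (F r) (a i + s i) = 1 := by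
    intro i
    set y := ∑ j ∈ Finset.range (i + 1), f j r with hy
    have h1 : ∀ k < a i + s i + t i, e.repr (S (F r - y) - (r : ℂ) • (F r - y)) k = 0 := by
      intro k hk
      have h2 : S (F r - y) - (r : ℂ) • (F r - y) = ∑' j, E (j + (i + 1)) r := by
        have h3 := hEsum.sum_add_tsum_nat_add (i + 1)
        rw [hsumE, ← hy, ← hGE ⟨r, hzU⟩, hF] at h3
        rw [map_sub, smul_sub, sub_sub_sub_comm]
        exact sub_eq_of_eq_add' h3.symm
      rw [h2, e.repr_apply_apply]
      have h4 := ((summable_nat_add_iff (i + 1)).mpr hEsum).hasSum.mapL (innerSL ℂ (e k))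
      refine h4.unique ?_
      refine hasSum_zero.congr_fun fun j => ?_
      rw [innerSL_apply_apply, ← e.repr_apply_apply]
      exact hEzero i _ k (by omega) hk.le
    -- t i > 0 puts the peak strictly before the end of the block.
    have h2 := hS.repr_eq_zero_of_lt hz0 h1 (k := a i + s i) (by have := (hast i).2.2.1; omega)
    have h3 : e.repr (F r) (a i + s i) = e.repr y (a i + s i) := by
      rw [map_sub] at h2
      exact sub_eq_zero.mp h2
    rw [h3, hy, e.repr_apply_apply, inner_sum, Finset.sum_range_succ, Finset.sum_eq_zero, zero_add,
      ← e.repr_apply_apply, repr_shiftBlock, if_pos, sub_self, zpow_zero, mul_one,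
      div_self (hS.weightProd_pos _).ne', Complex.ofReal_one]
    · have := (hast i).2.2.1
      rw [Finset.mem_Ico]
      omega
    · intro j hj
      have h4 := (hast j).2.2.2
      have h5 := haj.monotone (Nat.succ_le_of_lt (Finset.mem_range.mp hj))
      rw [← e.repr_apply_apply, repr_shiftBlock, if_neg]
      rw [Finset.mem_Ico]
      rw [Nat.succ_eq_add_one] at h5
      omega
  have htend : Tendsto (fun i => a i + s i) atTop atTop :=
    tendsto_atTop_mono (fun i => Nat.le_add_right _ _) haj.tendsto_atTop
  -- Square-summable coordinates tend to 0, yet they equal 1 along the peaks.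
  have h0 := (e.hasSum_sq_norm_repr (F r)).summable.tendsto_atTop_zero.comp htend
  have h1 : Tendsto (fun _ : ℕ => (1 : ℝ)) atTop (𝓝 0) := by
    refine h0.congr fun i => ?_
    simp [hone i]
  exact one_ne_zero (tendsto_nhds_unique tendsto_const_nhds h1)

/-- With r₁(S) < Y < M < X < r(S), the strictness at M makes the annulus nonempty whichever pair of
rates, (X, M) or (M, Y), has peaks. -/
theorem IsUnilateralWeightedShift.innerRadius_eq_outerRadius {H : Type*}
    [NormedAddCommGroup H] [InnerProductSpace ℂ H] [CompleteSpace H] {e : HilbertBasis ℕ ℂ H}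
    {ω : ℕ → ℝ} {S : H →L[ℂ] H} (hS : IsUnilateralWeightedShift e ω S) (hβ : HasBishopBeta S) :
    innerRadius S = outerRadius S := by
  have := nontrivial e
  refine (innerRadius_le_outerRadius S).eq_or_lt.resolve_right fun hlt => ?_
  obtain ⟨M, hM1, hM2⟩ := exists_between hlt
  obtain ⟨Y, hY1, hY2⟩ := exists_between hM1
  obtain ⟨X, hX1, hX2⟩ := exists_between hM2
  have hY : 0 < Y := (innerRadius_nonneg S).trans_lt hY1
  have hM : 0 < M := hY.trans hY2
  rcases hasPeaks_or_hasPeaks hS.weightProd_pos hY hY2.le hX1.le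
    (hS.exists_growth (hM.trans hX1) hX2) (hS.exists_decay hY hY1) with h | h
  · exact hS.not_hasBishopBeta_of_hasPeaks hM hX1 h hβ
  · exact hS.not_hasBishopBeta_of_hasPeaks hY hY2 h hβ

theorem theorem3 {H : Type*} [NormedAddCommGroup H] [InnerProductSpace ℂ H] [CompleteSpace H]
    (e : HilbertBasis ℕ ℂ H) (ω : ℕ → ℝ) (S : H →L[ℂ] H)
    (hS : IsUnilateralWeightedShift e ω S) :
    (HasBishopBeta S → innerRadius S = outerRadius S) ∧
      (innerRadius S = outerRadius S →
        HasBishopBeta S ∨ sigmaBeta S = {z : ℂ | ‖z‖ = outerRadius S}) :=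
  ⟨hS.innerRadius_eq_outerRadius, hS.hasBishopBeta_or_sigmaBeta_eq⟩
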